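/- Call a two-qubit state (a positive semidefinite operator $\rho^{AB}$ on $\mathbb{C}^2\otimes\mathbb{C}^2$ of trace $1$) *symmetrically extendible* if there is a state $\rho^{ABB'}$ on $\mathbb{C}^2\otimes\mathbb{C}^2\otimes\mathbb{C}^2$ that is invariant under conjugation by the operator exchanging the factors $B$ and $B'$ and satisfies $\operatorname{tr}_{B'}\rho^{ABB'}=\rho^{AB}$. Let $S=|0\rangle\langle 0|+\mathrm{i}\,|1\rangle\langle 1|$ be the phase gate. **Theorem.** A two-qubit state $\rho^{AB}$ is invariant under $S^\dagger\otimes S$, that is, $(S^\dagger\otimes S)\,\rho^{AB}\,(S^\dagger\otimes S)^\dagger=\rho^{AB}$, if and only if in the product basis $|00\rangle,|01\rangle,|10\rangle,|11\rangle$ it has the form $$\rho^{AB}=\begin{bmatrix}p_1&0&0&x\\0&p_2&0&0\\0&0&p_3&0\\\bar x&0&0&p_4\end{bmatrix}$$ with $p_1,p_2,p_3,p_4\in\mathbb{R}$ and $x\in\mathbb{C}$. Every two-qubit state $\rho^{AB}$ of this form, with reduced state $\rho^B=\operatorname{tr}_A\rho^{AB}$, is symmetrically extendible if and only if $$\operatorname{tr}[(\rho^B)^2]\;\ge\;\operatorname{tr}[(\rho^{AB})^2]-4\sqrt{\det\rho^{AB}}.$$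 -/

import Mathlib

open scoped Kronecker ComplexConjugate ComplexOrder

/-- A quantum state (density operator) on a finite-dimensional system with orthonormal basis
indexed by `n`: a positive semidefinite matrix of trace one. -/
def IsState {n : Type*} [Fintype n] (ρ : Matrix n n ℂ) : Prop :=
  ρ.PosSemidef ∧ ρ.trace = 1

/-- The reduced state on `B`: the partial trace over `A` of an operator on `A ⊗ B`. -/
def reducedB {A B : Type*} [Fintype A] (ρ : Matrix (A × B) (A × B) ℂ) : Matrix B B ℂ :=
  Matrix.of fun b b' => ∑ a, ρ (a, b) (a, b')

/-- The partial trace over the last factor of an operator on `A ⊗ B ⊗ B'`, where `B'` is a copy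
of `B`. -/
def traceOutCopy {A B : Type*} [Fintype B] (σ : Matrix (A × B × B) (A × B × B) ℂ) :
    Matrix (A × B) (A × B) ℂ :=
  Matrix.of fun i j => ∑ c, σ (i.1, i.2, c) (j.1, j.2, c)

/-- Conjugation by the operator that exchanges the two factors `B` and `B'` of `A ⊗ B ⊗ B'`:
both the rows and the columns are permuted by `|a b c⟩ ↦ |a c b⟩`. -/
def exchangeCopies {A B : Type*} (σ : Matrix (A × B × B) (A × B × B) ℂ) :
    Matrix (A × B × B) (A × B × B) ℂ :=
  σ.submatrix (fun i => (i.1, i.2.2, i.2.1)) (fun j => (j.1, j.2.2, j.2.1))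

/-- `ρ` on `A ⊗ B` has a symmetric extension: there is a state on `A ⊗ B ⊗ B'` that is invariant
under the exchange of `B` and `B'` and reduces to `ρ` when `B'` is traced out. -/
def HasSymmetricExtension {A B : Type*} [Fintype A] [Fintype B]
    (ρ : Matrix (A × B) (A × B) ℂ) : Prop :=
  ∃ σ : Matrix (A × B × B) (A × B × B) ℂ,
    IsState σ ∧ exchangeCopies σ = σ ∧ traceOutCopy σ = ρ

/-- The phase gate `S = |0⟩⟨0| + i |1⟩⟨1|`. -/
def phaseGate : Matrix (Fin 2) (Fin 2) ℂ :=
  !![1, 0; 0, Complex.I]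

/-- Invariance of a two-qubit operator under the local unitary operator `S† ⊗ S`. -/
def PhaseInvariant (ρ : Matrix (Fin 2 × Fin 2) (Fin 2 × Fin 2) ℂ) : Prop :=
  (phaseGate.conjTranspose ⊗ₖ phaseGate) * ρ *
    (phaseGate.conjTranspose ⊗ₖ phaseGate).conjTranspose = ρ

/-- The Hermitian two-qubit operator with diagonal `p₁, p₂, p₃, p₄` and antidiagonal
`x, y, ȳ, x̄` in the product basis `|00⟩, |01⟩, |10⟩, |11⟩`
(`finProdFinEquiv` sends `(a, b)` to `2 a + b`). -/
def zCorrForm (p₁ p₂ p₃ p₄ : ℝ) (x y : ℂ) : Matrix (Fin 2 × Fin 2) (Fin 2 × Fin 2) ℂ :=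
  (!![(p₁ : ℂ), 0, 0, x;
      0, (p₂ : ℂ), y, 0;
      0, conj y, (p₃ : ℂ), 0;
      conj x, 0, 0, (p₄ : ℂ)]).submatrix finProdFinEquiv finProdFinEquiv

/-! Conjugation by `S† ⊗ S` multiplies the entry of `ρ` at `(a b, a' b')` by
`i ^ ((b - a) - (b' - a'))`,
so the invariant operators are those that vanish between basis vectors of different charge `b - a`.
The charges of `|00⟩, |01⟩, |10⟩, |11⟩` are `0, 1, -1, 0`, which leaves only the diagonal and the
corner entry `x`.

Symmetric extendibility of such a state is first turned into a finite system of inequalities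
(`hasSymmetricExtension_zCorrForm_iff`). In an extension `σ` put `t = ⟨001|σ|001⟩`,
`r = ⟨101|σ|101⟩`, `u = ⟨000|σ|110⟩` and `v = ⟨001|σ|111⟩`. The partial trace gives `x = u + v`
and bounds `t` by `p₁, p₂` and `r` by `p₃, p₄`; two principal minors of `σ` give
`|u|² ≤ (p₁ - t) r` and `|v|² ≤ t (p₄ - r)`. Conversely such numbers define an extension that is block
diagonal with respect to the charge `b + c - a` of `|a b c⟩` and has a constant entry on each pair of
classes of basis vectors under the exchange. It is the pullback, along the map that sends a basis
vector to its class, of a block diagonal matrix with `2 × 2` blocks, and so it is positive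
semidefinite as soon as these blocks are.

In terms of the entries the trace inequality reads
`|x|² ≤ p₁ p₃ + p₂ p₄ + 2 √(p₂ p₃ (p₁ p₄ - |x|²))`. If `t, r, u, v` exist, then
`X = √((p₁ - t) r) + √(t (p₄ - r))` is at least `|x|`, and the inequality for `|x|` follows from
`p₁ p₄ - X² = (√((p₁ - t) (p₄ - r)) - √(t r))²` (`norm_sq_le_of_split`). For the converse
(`exists_split_of_norm_sq_le`), if `p₁ p₄ ≤ p₁ p₃ + p₂ p₄` there are admissible `t, r` with
`r p₁ + t p₄ = p₁ p₄`, for which `X² = p₁ p₄`, and positivity of the state gives `|x|² ≤ p₁ p₄`.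
Otherwise `t = p₂, r = p₃` are admissible, and the trace inequality, which is an equality at
`|x| = X` and fails for larger `|x|`, gives `|x| ≤ X`. -/

/-! ### Positive semidefinite matrices -/

/-- The principal `2 × 2` minors of a positive semidefinite matrix are nonnegative. -/
theorem Matrix.PosSemidef.norm_apply_sq_le {n : Type*} {M : Matrix n n ℂ} (hM : M.PosSemidef)
    (i j : n) : ‖M i j‖ ^ 2 ≤ (M i i).re * (M j j).re := by
  have hdet := (hM.submatrix ![i, j]).det_nonneg
  have hji : M j i = conj (M i j) := (hM.isHermitian.apply j i).symm
  have hi := (Complex.nonneg_iff.1 (hM.diag_nonneg (i := i))).2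
  have hj := (Complex.nonneg_iff.1 (hM.diag_nonneg (i := j))).2
  rw [Matrix.det_fin_two] at hdet
  have h := (Complex.nonneg_iff.1 hdet).1
  simp only [Matrix.submatrix_apply, Matrix.cons_val_zero, Matrix.cons_val_one, hji,
    Complex.mul_conj, Complex.sub_re, Complex.mul_re, Complex.ofReal_re, ← hi, ← hj] at h
  rw [Complex.normSq_eq_norm_sq] at h
  linarith

open scoped Matrix in
theorem Matrix.posSemidef_fin_two {a d : ℝ} {b : ℂ} (ha : 0 ≤ a) (hd : 0 ≤ d)
    (hb : ‖b‖ ^ 2 ≤ a * d) :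
    (!![(a : ℂ), b; conj b, (d : ℂ)]).PosSemidef := by
  refine .of_dotProduct_mulVec_nonneg ?_ fun z => ?_
  · ext i j
    fin_cases i <;> fin_cases j <;> simp
  · have key : star z ⬝ᵥ (!![(a : ℂ), b; conj b, (d : ℂ)] *ᵥ z) =
        ((a * ‖z 0‖ ^ 2 + d * ‖z 1‖ ^ 2 + 2 * (conj (z 0) * b * z 1).re : ℝ) : ℂ) := by
      apply Complex.ext <;>
        simp [Matrix.mulVec, dotProduct, Fin.sum_univ_two, ← Complex.normSq_eq_norm_sq,
          Complex.normSq_apply, -Complex.inner] <;> ring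
    rw [key]
    refine Complex.zero_le_real.2 ?_
    have h1 : |(conj (z 0) * b * z 1).re| ≤ ‖z 0‖ * ‖b‖ * ‖z 1‖ := by
      simpa using Complex.abs_re_le_norm (conj (z 0) * b * z 1)
    have h2 : ‖b‖ ≤ √a * √d := by
      rw [← Real.sqrt_mul ha]
      exact Real.le_sqrt_of_sq_le hb
    have h3 : ‖z 0‖ * ‖b‖ * ‖z 1‖ ≤ ‖z 0‖ * (√a * √d) * ‖z 1‖ := by gcongr
    have h4 := (abs_le.1 h1).1
    nlinarith [sq_nonneg (√a * ‖z 0‖ - √d * ‖z 1‖), Real.sq_sqrt ha, Real.sq_sqrt hd]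

open scoped Matrix in
theorem Matrix.PosSemidef.blockDiagonal {m o : Type*} [Fintype m] [Fintype o] [DecidableEq o]
    {M : o → Matrix m m ℂ} (hM : ∀ k, (M k).PosSemidef) :
    (Matrix.blockDiagonal M).PosSemidef := by
  refine .of_dotProduct_mulVec_nonneg
    (Matrix.isHermitian_blockDiagonal_iff.2 fun k => (hM k).isHermitian) fun z => ?_
  have key : star z ⬝ᵥ (Matrix.blockDiagonal M *ᵥ z) =
      ∑ k, star (fun i => z (i, k)) ⬝ᵥ (M k *ᵥ fun i => z (i, k)) := by
    simp only [dotProduct, Matrix.mulVec, Matrix.blockDiagonal_apply, Fintype.sum_prod_type,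
      ite_mul, zero_mul, Finset.sum_ite_eq, Finset.mem_univ, if_true, Pi.star_apply]
    exact Finset.sum_comm
  rw [key]
  exact Finset.sum_nonneg fun k _ => (hM k).dotProduct_mulVec_nonneg _

/-! ### Invariance under the phase gate -/

theorem phaseInvariant_iff {ρ : Matrix (Fin 2 × Fin 2) (Fin 2 × Fin 2) ℂ} (hρ : ρ.IsHermitian) :
    PhaseInvariant ρ ↔ ∃ (p₁ p₂ p₃ p₄ : ℝ) (x : ℂ), ρ = zCorrForm p₁ p₂ p₃ p₄ x 0 := by
  have hU : phaseGate.conjTranspose ⊗ₖ phaseGate =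
      Matrix.diagonal fun i : Fin 2 × Fin 2 => (![1, -Complex.I] i.1) * (![1, Complex.I] i.2) := by
    ext ⟨a, b⟩ ⟨a', b'⟩
    fin_cases a <;> fin_cases b <;> fin_cases a' <;> fin_cases b' <;>
      simp [phaseGate, Matrix.kroneckerMap_apply]
  have hdiag (i) : (((ρ i i).re : ℝ) : ℂ) = ρ i i := hρ.coe_re_apply_self i
  constructor
  · intro h
    have hzero (i j : Fin 2 × Fin 2)
        (hc : (![1, -Complex.I] i.1 * ![1, Complex.I] i.2) *
          conj (![1, -Complex.I] j.1 * ![1, Complex.I] j.2) ≠ 1) : ρ i j = 0 := by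
      have hij := congrFun (congrFun h i) j
      rw [hU, Matrix.diagonal_conjTranspose, Matrix.mul_diagonal, Matrix.diagonal_mul,
        mul_right_comm] at hij
      exact (mul_left_eq_self₀.1 hij).resolve_left hc
    have h10 : conj (ρ (0, 0) (1, 1)) = ρ (1, 1) (0, 0) := hρ.apply _ _
    refine ⟨(ρ (0, 0) (0, 0)).re, (ρ (0, 1) (0, 1)).re, (ρ (1, 0) (1, 0)).re,
      (ρ (1, 1) (1, 1)).re, ρ (0, 0) (1, 1), ?_⟩
    rw [zCorrForm, hdiag, hdiag, hdiag, hdiag, h10]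
    ext ⟨a, b⟩ ⟨a', b'⟩
    fin_cases a <;> fin_cases b <;> fin_cases a' <;> fin_cases b' <;>
      first
      | rfl
      | (refine (hzero _ _ ?_).trans ?_ <;> norm_num [finProdFinEquiv, Complex.ext_iff])
  · rintro ⟨p₁, p₂, p₃, p₄, x, rfl⟩
    rw [PhaseInvariant, hU, Matrix.diagonal_conjTranspose]
    ext ⟨a, b⟩ ⟨a', b'⟩
    rw [Matrix.mul_diagonal, Matrix.diagonal_mul]
    fin_cases a <;> fin_cases b <;> fin_cases a' <;> fin_cases b' <;>
      simp [zCorrForm, finProdFinEquiv, mul_right_comm]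

/-! ### Extensions in terms of the entries -/

/-- A symmetric extension `σ` matters only through `t = ⟨001|σ|001⟩`, `r = ⟨101|σ|101⟩`,
`u = ⟨000|σ|110⟩` and `v = ⟨001|σ|111⟩`. -/
theorem hasSymmetricExtension_zCorrForm_iff {p₁ p₂ p₃ p₄ : ℝ} {x : ℂ}
    (hρ : IsState (zCorrForm p₁ p₂ p₃ p₄ x 0)) :
    HasSymmetricExtension (zCorrForm p₁ p₂ p₃ p₄ x 0) ↔
      ∃ (t r : ℝ) (u v : ℂ), 0 ≤ t ∧ t ≤ p₁ ∧ t ≤ p₂ ∧ 0 ≤ r ∧ r ≤ p₃ ∧ r ≤ p₄ ∧ x = u + v ∧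
        ‖u‖ ^ 2 ≤ (p₁ - t) * r ∧ ‖v‖ ^ 2 ≤ t * (p₄ - r) := by
  constructor
  · rintro ⟨σ, ⟨hσ, -⟩, hex, htr⟩
    have hpos (i) : 0 ≤ (σ i i).re := (Complex.nonneg_iff.1 hσ.diag_nonneg).1
    have hswap (a b c a' b' c' : Fin 2) : σ (a, c, b) (a', c', b') = σ (a, b, c) (a', b', c') :=
      congrFun (congrFun hex (a, b, c)) (a', b', c')
    have hent (a b a' b' : Fin 2) : σ (a, b, 0) (a', b', 0) + σ (a, b, 1) (a', b', 1) =
        zCorrForm p₁ p₂ p₃ p₄ x 0 (a, b) (a', b') := by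
      rw [← htr]; simp [traceOutCopy, Fin.sum_univ_two]
    have h1 := congrArg Complex.re (hent 0 0 0 0)
    have h2 := congrArg Complex.re (hent 0 1 0 1)
    have h3 := congrArg Complex.re (hent 1 0 1 0)
    have h4 := congrArg Complex.re (hent 1 1 1 1)
    have hx := hent 0 0 1 1
    rw [hswap 0 0 1 0 0 1] at h2
    rw [hswap 1 0 1 1 0 1] at h4
    simp [zCorrForm, finProdFinEquiv] at h1 h2 h3 h4 hx
    have hu := hσ.norm_apply_sq_le (0, 0, 0) (1, 1, 0)
    have hv := hσ.norm_apply_sq_le (0, 0, 1) (1, 1, 1)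
    rw [hswap 1 0 1 1 0 1] at hu
    have e1 : (σ (0, 0, 0) (0, 0, 0)).re = p₁ - (σ (0, 0, 1) (0, 0, 1)).re := by linarith
    have e4 : (σ (1, 1, 1) (1, 1, 1)).re = p₄ - (σ (1, 0, 1) (1, 0, 1)).re := by linarith
    rw [e1] at hu
    rw [e4] at hv
    exact ⟨_, _, _, _, hpos (0, 0, 1), by linarith [hpos (0, 0, 0)], by linarith [hpos (0, 1, 1)],
      hpos (1, 0, 1), by linarith [hpos (1, 0, 0)], by linarith [hpos (1, 1, 1)], hx.symm, hu, hv⟩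
  · rintro ⟨t, r, u, v, ht, ht1, ht2, hr, hr3, hr4, rfl, hu, hv⟩
    -- The blocks of charge `0`, `1` and `2 ≡ -1` modulo `3`. In each of them the two exchange
    -- classes are told apart by `a`: they are `{000}, {101, 110}` for charge `0`,
    -- `{001, 010}, {111}` for charge `1`, and `{011}, {100}` for the last block.
    set N : Fin 3 → Matrix (Fin 2) (Fin 2) ℂ :=
      ![!![((p₁ - t : ℝ) : ℂ), u; conj u, (r : ℂ)],
        !![(t : ℂ), v; conj v, ((p₄ - r : ℝ) : ℂ)],
        !![((p₂ - t : ℝ) : ℂ), 0; conj 0, ((p₃ - r : ℝ) : ℂ)]] with hN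
    have hNpos : (Matrix.blockDiagonal N).PosSemidef := by
      refine Matrix.PosSemidef.blockDiagonal fun k => ?_
      fin_cases k
      · exact Matrix.posSemidef_fin_two (by linarith) hr hu
      · exact Matrix.posSemidef_fin_two ht (by linarith) hv
      · refine Matrix.posSemidef_fin_two (by linarith) (by linarith) ?_
        have := mul_nonneg (sub_nonneg.2 ht2) (sub_nonneg.2 hr3)
        simpa using this
    -- `g` sends `|a b c⟩` to its exchange class, given by `a` and the charge modulo `3`.
    let g : Fin 2 × Fin 2 × Fin 2 → Fin 2 × Fin 3 := fun i =>
      (i.1, Fin.castSucc i.2.1 + Fin.castSucc i.2.2 - Fin.castSucc i.1)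
    have htr : traceOutCopy ((Matrix.blockDiagonal N).submatrix g g) =
        zCorrForm p₁ p₂ p₃ p₄ (u + v) 0 := by
      ext ⟨a, b⟩ ⟨a', b'⟩
      fin_cases a <;> fin_cases b <;> fin_cases a' <;> fin_cases b' <;>
        simp [traceOutCopy, zCorrForm, finProdFinEquiv, Fin.sum_univ_two,
          Matrix.blockDiagonal_apply, g, hN]
      exact fun h => absurd h (by decide)
    refine ⟨(Matrix.blockDiagonal N).submatrix g g, ⟨hNpos.submatrix g, ?_⟩, ?_, htr⟩
    · have h := hρ.2
      rw [← htr] at h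
      simpa [Matrix.trace, Fintype.sum_prod_type, traceOutCopy] using h
    · ext i j
      simp only [exchangeCopies, Matrix.submatrix_apply, g, add_comm]

/-! ### The inequality between the entries -/

/-- With `s = p₁ - t` and `m = p₄ - r` fixed, the right-hand side grows with `p₂` and `p₃` and
decreases in `‖u + v‖`, so the worst case is `p₂ = t`, `p₃ = r`, `‖u + v‖ = √(s r) + √(t m)`. -/
theorem norm_sq_le_of_split {p₁ p₂ p₃ p₄ t r : ℝ} {u v : ℂ} (ht : 0 ≤ t) (ht1 : t ≤ p₁)
    (ht2 : t ≤ p₂) (hr : 0 ≤ r) (hr3 : r ≤ p₃) (hr4 : r ≤ p₄)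
    (hu : ‖u‖ ^ 2 ≤ (p₁ - t) * r) (hv : ‖v‖ ^ 2 ≤ t * (p₄ - r)) :
    ‖u + v‖ ^ 2 ≤ p₁ * p₃ + p₂ * p₄ + 2 * √(p₂ * p₃ * (p₁ * p₄ - ‖u + v‖ ^ 2)) := by
  obtain ⟨s, rfl⟩ : ∃ s, p₁ = s + t := ⟨p₁ - t, by ring⟩
  obtain ⟨m, rfl⟩ : ∃ m, p₄ = m + r := ⟨p₄ - r, by ring⟩
  have hs : 0 ≤ s := by linarith
  have hm : 0 ≤ m := by linarith
  simp only [add_sub_cancel_right] at hu hv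
  have hS := Real.sq_sqrt hs
  have hT := Real.sq_sqrt ht
  have hR := Real.sq_sqrt hr
  have hM := Real.sq_sqrt hm
  have hX : ‖u + v‖ ≤ √s * √r + √t * √m := by
    rw [← Real.sqrt_mul hs, ← Real.sqrt_mul ht]
    exact (norm_add_le u v).trans
      (add_le_add (Real.le_sqrt_of_sq_le hu) (Real.le_sqrt_of_sq_le hv))
  have hX2 : ‖u + v‖ ^ 2 ≤ (√s * √r + √t * √m) ^ 2 := by gcongr
  -- `(s + t) (m + r) - X² = (√s √m - √t √r)²`
  have hroot : √t * √r * (√s * √m - √t * √r) ≤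
      √(p₂ * p₃ * ((s + t) * (m + r) - ‖u + v‖ ^ 2)) := by
    apply Real.le_sqrt_of_sq_le
    rw [mul_pow]
    have h1 : (√t * √r) ^ 2 ≤ p₂ * p₃ := by
      rw [mul_pow, hT, hR]
      exact mul_le_mul ht2 hr3 hr (by linarith)
    have h2 : (√s * √m - √t * √r) ^ 2 ≤ (s + t) * (m + r) - ‖u + v‖ ^ 2 := by
      have : (s + t) * (m + r) = (√s * √r + √t * √m) ^ 2 + (√s * √m - √t * √r) ^ 2 := by
        linear_combination (-(m + r)) * hS - (m + r) * hT - (√s ^ 2 + √t ^ 2) * (hM + hR)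
      linarith
    exact mul_le_mul h1 h2 (sq_nonneg _) (le_trans (sq_nonneg _) h1)
  have h3 : (s + t) * r + t * (m + r) ≤ (s + t) * p₃ + p₂ * (m + r) :=
    add_le_add (mul_le_mul_of_nonneg_left hr3 (by linarith))
      (mul_le_mul_of_nonneg_right ht2 (by linarith))
  have h4 : (s + t) * r + t * (m + r) + 2 * (√t * √r * (√s * √m - √t * √r)) =
      (√s * √r + √t * √m) ^ 2 := by
    linear_combination (-r) * hS - √s ^ 2 * hR - (m + 2 * r) * hT + √t ^ 2 * (-hM - 2 * hR)
  linarith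

theorem exists_split_of_norm_sq_le {p₁ p₂ p₃ p₄ : ℝ} {x : ℂ} (h1 : 0 ≤ p₁) (h2 : 0 ≤ p₂)
    (h3 : 0 ≤ p₃) (h4 : 0 ≤ p₄) (hx : ‖x‖ ^ 2 ≤ p₁ * p₄)
    (h : ‖x‖ ^ 2 ≤ p₁ * p₃ + p₂ * p₄ + 2 * √(p₂ * p₃ * (p₁ * p₄ - ‖x‖ ^ 2))) :
    ∃ (t r : ℝ) (u v : ℂ), 0 ≤ t ∧ t ≤ p₁ ∧ t ≤ p₂ ∧ 0 ≤ r ∧ r ≤ p₃ ∧ r ≤ p₄ ∧ x = u + v ∧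
      ‖u‖ ^ 2 ≤ (p₁ - t) * r ∧ ‖v‖ ^ 2 ≤ t * (p₄ - r) := by
  rcases h1.eq_or_lt with rfl | hp1
  · have : x = 0 := by
      rw [← norm_eq_zero, ← sq_eq_zero_iff]
      exact le_antisymm (by simpa using hx) (sq_nonneg _)
    exact ⟨0, 0, 0, 0, by simp [*]⟩
  rcases le_or_gt (p₁ * p₄) (p₁ * p₃ + p₂ * p₄) with hle | hlt
  · -- Here every `x` with `‖x‖² ≤ p₁ p₄` can be split, in the ratio `p₁ - t : t`.
    -- `t = min p₁ p₂`, and `r` is the solution of `r p₁ + t p₄ = p₁ p₄`.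
    obtain ⟨t, ht, ht1, ht2, htle⟩ :
        ∃ t, 0 ≤ t ∧ t ≤ p₁ ∧ t ≤ p₂ ∧ p₄ * (p₁ - t) ≤ p₃ * p₁ := by
      rcases le_total p₁ p₂ with h12 | h12
      · exact ⟨p₁, h1, le_rfl, h12, by simpa using mul_nonneg h3 h1⟩
      · exact ⟨p₂, h2, h12, le_rfl, by linarith⟩
    have hs : 0 ≤ p₁ - t := sub_nonneg.2 ht1
    have hsplit (c : ℝ) (hc : 0 ≤ c) :
        ‖((c / p₁ : ℝ) : ℂ) * x‖ ^ 2 ≤ c * (p₄ * c / p₁) := by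
      rw [norm_mul, mul_pow, Complex.norm_real, Real.norm_eq_abs, sq_abs]
      calc (c / p₁) ^ 2 * ‖x‖ ^ 2 ≤ (c / p₁) ^ 2 * (p₁ * p₄) := by gcongr
        _ = c * (p₄ * c / p₁) := by field_simp
    refine ⟨t, p₄ * (p₁ - t) / p₁, ((p₁ - t) / p₁ : ℝ) * x, (t / p₁ : ℝ) * x, ht, ht1, ht2,
      by positivity, (div_le_iff₀ hp1).2 htle, (div_le_iff₀ hp1).2 (by nlinarith), ?_,
      hsplit _ hs, ?_⟩
    · rw [← add_mul, ← Complex.ofReal_add, ← add_div, sub_add_cancel, div_self hp1.ne']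
      simp
    · convert hsplit t ht using 2
      field_simp
      ring
  · -- Here `t = p₂` and `r = p₃`, and `a + b` below is the largest possible `‖u + v‖`.
    have h12 : p₂ ≤ p₁ := by nlinarith [mul_nonneg h1 h3]
    have h34 : p₃ ≤ p₄ := by nlinarith [mul_nonneg h2 h4]
    obtain ⟨s, rfl⟩ : ∃ s, p₁ = s + p₂ := ⟨p₁ - p₂, by ring⟩
    obtain ⟨m, rfl⟩ : ∃ m, p₄ = m + p₃ := ⟨p₄ - p₃, by ring⟩
    have hs : 0 ≤ s := by linarith
    have hm : 0 ≤ m := by linarith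
    have hS := Real.sq_sqrt hs
    have hT := Real.sq_sqrt h2
    have hR := Real.sq_sqrt h3
    have hM := Real.sq_sqrt hm
    set a := √s * √p₃ with ha
    set b := √p₂ * √m with hb
    have ha0 : 0 ≤ a := by positivity
    have hb0 : 0 ≤ b := by positivity
    have hab : ‖x‖ ≤ a + b := by
      by_contra! hlt'
      have hsq : (a + b) ^ 2 < ‖x‖ ^ 2 := by gcongr
      have hd : 0 ≤ √s * √m - √p₂ * √p₃ := by
        rw [← Real.sqrt_mul hs, ← Real.sqrt_mul h2, sub_nonneg]
        exact Real.sqrt_le_sqrt (by nlinarith)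
      have hid : (s + p₂) * (m + p₃) - (a + b) ^ 2 = (√s * √m - √p₂ * √p₃) ^ 2 := by
        rw [ha, hb]
        linear_combination (-(m + p₃)) * hS - (m + p₃) * hT - (√s ^ 2 + √p₂ ^ 2) * (hM + hR)
      have hroot : √(p₂ * p₃ * ((s + p₂) * (m + p₃) - ‖x‖ ^ 2)) ≤
          √p₂ * √p₃ * (√s * √m - √p₂ * √p₃) := by
        apply Real.sqrt_le_iff.2 ⟨by positivity, ?_⟩
        rw [mul_pow, mul_pow, hT, hR, ← hid]
        gcongr
      have hid2 : (s + p₂) * p₃ + p₂ * (m + p₃) +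
          2 * (√p₂ * √p₃ * (√s * √m - √p₂ * √p₃)) = (a + b) ^ 2 := by
        rw [ha, hb]
        linear_combination (-p₃) * hS - √s ^ 2 * hR - (m + 2 * p₃) * hT +
          √p₂ ^ 2 * (-hM - 2 * hR)
      linarith
    -- If `a + b = 0`, then `x = 0` and both parts are zero.
    have hsplit (c : ℝ) (hc : 0 ≤ c) : ‖((c / (a + b) : ℝ) : ℂ) * x‖ ^ 2 ≤ c ^ 2 := by
      gcongr
      rw [norm_mul, Complex.norm_real, Real.norm_of_nonneg (by positivity)]
      calc c / (a + b) * ‖x‖ ≤ c / (a + b) * (a + b) := by gcongr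
        _ ≤ c := by
          rcases eq_or_ne (a + b) 0 with h0 | h0
          · simpa [h0] using hc
          · rw [div_mul_cancel₀ _ h0]
    refine ⟨p₂, p₃, (a / (a + b) : ℝ) * x, (b / (a + b) : ℝ) * x, h2, h12, le_rfl, h3, le_rfl,
      h34, ?_, (hsplit a ha0).trans_eq ?_, (hsplit b hb0).trans_eq ?_⟩
    · rcases eq_or_ne (a + b) 0 with h0 | h0
      · have : x = 0 := norm_le_zero_iff.1 (h0 ▸ hab)
        simp [this]
      · rw [← add_mul, ← Complex.ofReal_add, ← add_div, div_self h0]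
        simp
    · rw [ha, mul_pow, hS, hR]; ring
    · rw [hb, mul_pow, hT, hM]; ring

/-! ### The trace inequality -/

theorem trace_inequality_zCorrForm_iff (p₁ p₂ p₃ p₄ : ℝ) (x : ℂ) :
    (reducedB (zCorrForm p₁ p₂ p₃ p₄ x 0) * reducedB (zCorrForm p₁ p₂ p₃ p₄ x 0)).trace.re ≥
        (zCorrForm p₁ p₂ p₃ p₄ x 0 * zCorrForm p₁ p₂ p₃ p₄ x 0).trace.re -
          4 * √(zCorrForm p₁ p₂ p₃ p₄ x 0).det.re ↔
      ‖x‖ ^ 2 ≤ p₁ * p₃ + p₂ * p₄ + 2 * √(p₂ * p₃ * (p₁ * p₄ - ‖x‖ ^ 2)) := by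
  have hB : (reducedB (zCorrForm p₁ p₂ p₃ p₄ x 0) *
      reducedB (zCorrForm p₁ p₂ p₃ p₄ x 0)).trace.re = (p₁ + p₃) ^ 2 + (p₂ + p₄) ^ 2 := by
    simp [reducedB, zCorrForm, finProdFinEquiv, Matrix.trace, Matrix.mul_apply, Fin.sum_univ_two]
    ring
  have hAB : (zCorrForm p₁ p₂ p₃ p₄ x 0 * zCorrForm p₁ p₂ p₃ p₄ x 0).trace.re =
      p₁ ^ 2 + p₂ ^ 2 + p₃ ^ 2 + p₄ ^ 2 + 2 * ‖x‖ ^ 2 := by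
    simp [zCorrForm, finProdFinEquiv, Matrix.trace, Matrix.mul_apply, Fin.sum_univ_two,
      Fintype.sum_prod_type, ← Complex.normSq_eq_norm_sq, Complex.normSq_apply]
    ring
  have hdet : (zCorrForm p₁ p₂ p₃ p₄ x 0).det.re = p₂ * p₃ * (p₁ * p₄ - ‖x‖ ^ 2) := by
    rw [zCorrForm, Matrix.det_submatrix_equiv_self, Matrix.det_succ_row_zero,
      ← Complex.normSq_eq_norm_sq, Complex.normSq_apply]
    simp [Fin.sum_univ_succ, Matrix.det_fin_three, Fin.succAbove, pow_succ]
    ring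
  rw [hB, hAB, hdet, ge_iff_le]
  constructor <;> intro h <;> linarith

/-- The traces and the determinant below are those of Hermitian matrices, hence real numbers;
`.re` only reads them as such. -/
theorem mainTheorem6 (ρ : Matrix (Fin 2 × Fin 2) (Fin 2 × Fin 2) ℂ) (hρ : IsState ρ) :
    (PhaseInvariant ρ ↔
      ∃ (p₁ p₂ p₃ p₄ : ℝ) (x : ℂ), ρ = zCorrForm p₁ p₂ p₃ p₄ x 0) ∧
    (∀ (p₁ p₂ p₃ p₄ : ℝ) (x : ℂ), ρ = zCorrForm p₁ p₂ p₃ p₄ x 0 →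
      (HasSymmetricExtension ρ ↔
        (reducedB ρ * reducedB ρ).trace.re ≥
          (ρ * ρ).trace.re - 4 * Real.sqrt ρ.det.re)) := by
  refine ⟨phaseInvariant_iff hρ.1.isHermitian, ?_⟩
  rintro p₁ p₂ p₃ p₄ x rfl
  rw [hasSymmetricExtension_zCorrForm_iff hρ, trace_inequality_zCorrForm_iff]
  constructor
  · rintro ⟨t, r, u, v, ht, ht1, ht2, hr, hr3, hr4, rfl, hu, hv⟩
    exact norm_sq_le_of_split ht ht1 ht2 hr hr3 hr4 hu hv
  · have hpos (i) := (Complex.nonneg_iff.1 (hρ.1.diag_nonneg (i := i))).1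
    refine exists_split_of_norm_sq_le ?_ ?_ ?_ ?_ ?_
    · simpa [zCorrForm, finProdFinEquiv] using hpos (0, 0)
    · simpa [zCorrForm, finProdFinEquiv] using hpos (0, 1)
    · simpa [zCorrForm, finProdFinEquiv] using hpos (1, 0)
    · simpa [zCorrForm, finProdFinEquiv] using hpos (1, 1)
    · simpa [zCorrForm, finProdFinEquiv] using hρ.1.norm_apply_sq_le (0, 0) (1, 1)
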